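/- Let $(T_n(x))_{n\in\mathbb{Z}}$ and $(S_n(x))_{n\in\mathbb{Z}}$ be the Chebyshev polynomials of the first and second kind, i.e. the sequences of real polynomials with $T_0=1$, $T_1=x$, $S_0=1$, $S_1=2x$ and $T_{n+2}=2xT_{n+1}-T_n$, $S_{n+2}=2xS_{n+1}-S_n$ for all $n\in\mathbb{Z}$. For an integer $r\ge 0$ let $T_n^{\langle r\rangle}=T_nT_{n+1}\cdots T_{n+r-1}$ be the rising power, with $T_n^{\langle 0\rangle}=1$. Let $m\geq 1$ and $d\geq 1$ be integers, let $s,k,n$ be any integers, and let $(d_i)_{1\leq i\leq m}$ and $(e_i)_{1\leq i\leq m}$ be sequences of integers. Then the following hold. (1) $$\det\big([T_{s+k(n+i+j)}(x)^m]_{0\leq i,j\leq m}\big)=(x^2-1)^{\binom{m+1}{2}}\prod_{i=0}^m \binom{m}{i}\, S_{(i+1)k-1}(x)^{2(m-i)}.$$ (2) $$\det\Big(\Big[\prod_{f=j+1}^m T_{s+k(n+i+d_f)}(x)\prod_{g=1}^j T_{s+k(n+i+e_g)}(x)\Big]_{0\leq i,j\leq m}\Big)=(x^2-1)^{\binom{m+1}{2}}\prod_{l=1}^m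 S_{kl-1}(x)^{m+1-l}\prod_{1\leq i\leq j\leq m}S_{k(e_i-d_j)-1}(x).$$ (3) $$\det\Big(\Big[\frac{1}{T_{s+k(n+i+j)}(x)}\Big]_{0\leq i,j\leq m}\Big)=\frac{(-x^2+1)^{\binom{m+1}{2}}\prod_{i=0}^m S_{k(i+1)-1}(x)^{2(m-i)}}{\prod_{0\leq i,j\leq m}T_{s+k(n+i+j)}(x)},$$ as an identity of rational functions over $\mathbb{R}$, and also at every real number $x$ for which none of the denominators $T_{s+k(n+i+j)}(x)$, $0\le i,j\le m$, vanishes. (4) If $d\le m+1$, then $$\det\big([T_{n+i+j}(x)^{\langle m\rangle}]_{0\leq i,j\leq d-1}\big)=(-1)^{d\binom{d}{2}+\binom{d+1}{3}}(-x^2+1)^{\binom{d}{2}}\prod_{i=1}^{d-1}\big(S_{i-1}(x)S_{m-i}(x)\big)^{d-i}\prod_{i=d-1}^{2(d-1)}T_{n+i}(x)^{\langle m+1-d\rangle}.$$ If $d>m+1$, then this determinant is $0$ (in this case the product over $1\le i\le d-1$ contains the factor $S_{-1}(x)=0$). -/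

import Mathlib

open Polynomial

/-- The rising power `P_n^⟨m⟩ = P_n P_{n+1} ⋯ P_{n+m-1}` of a two-sided sequence of polynomials
(the empty product `1` for `m = 0`). -/
noncomputable def risingPower (P : ℤ → ℝ[X]) (n : ℤ) (m : ℕ) : ℝ[X] :=
  ∏ t ∈ Finset.range m, P (n + (t : ℤ))

/-- Chebyshev polynomials of the first kind, for all integer indices:
`T_0 = 1`, `T_1 = x`, `T_{n+2} = 2 x T_{n+1} - T_n`. -/
noncomputable abbrev chebT (n : ℤ) : ℝ[X] := Polynomial.Chebyshev.T ℝ n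

/-- Chebyshev polynomials of the second kind, for all integer indices:
`S_0 = 1`, `S_1 = 2 x`, `S_{n+2} = 2 x S_{n+1} - S_n`.
Mathlib calls them `U`; Mathlib's `Chebyshev.S` is a rescaled family. -/
noncomputable abbrev chebS (n : ℤ) : ℝ[X] := Polynomial.Chebyshev.U ℝ n

/-! ### Reindexing of triangular products -/

section Products

variable {M : Type*} [CommMonoid M]

/-! By the addition formula `chebT_add`, each Chebyshev factor is a linear form evaluated at a point
`(p_i, q_i)` that depends only on the row. An entry with `m` factors is thus a binary form of degree
`m`, and the matrix is a projective Vandermonde matrix times a coefficient matrix `C` free of `p`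
and `q`.

For powers, the binomial theorem makes `C` a diagonal matrix times another Vandermonde
(`det_pow_linear`). For products, `det C` is found by placing the points at the zeros of the forms,
where the matrix is triangular (`det_linearProductMatrix`). All remaining 2×2 minors are single
polynomials `chebS`, by `chebT_mul_chebS_sub`.

Reciprocals and rising powers reduce to the product case by pulling a factor out of each row. For `d
> m + 1` the rank is at most `m + 1`, so the determinant vanishes. -/

theorem prod_Ioi_fin_eq_prod_Icc {m : ℕ} (i : Fin (m + 1)) (f : ℕ → M) :
    ∏ j ∈ Finset.Ioi i, f (j : ℕ) = ∏ j ∈ Finset.Icc ((i : ℕ) + 1) m, f j := by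
  refine Finset.prod_bij (fun j _ => (j : ℕ)) ?_ ?_ ?_ ?_
  · intro j hj
    have h1 : (i : ℕ) < j := by simpa using hj
    have h2 := j.isLt
    simp only [Finset.mem_Icc]
    omega
  · intro j _ j' _ h
    exact Fin.ext h
  · intro j hj
    rw [Finset.mem_Icc] at hj
    exact ⟨⟨j, by omega⟩, by simp only [Finset.mem_Ioi, Fin.lt_def]; omega, rfl⟩
  · intros
    rfl

theorem prod_Iio_fin_eq_prod_range {m : ℕ} (j : Fin m) (f : ℕ → M) :
    ∏ i ∈ Finset.Iio j, f (i : ℕ) = ∏ i ∈ Finset.range j, f i := by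
  refine Finset.prod_bij (fun i _ => (i : ℕ)) ?_ ?_ ?_ ?_
  · intro i hi
    simpa using hi
  · intro i _ i' _ h
    exact Fin.ext h
  · intro i hi
    rw [Finset.mem_range] at hi
    exact ⟨⟨i, hi.trans j.isLt⟩, by simpa [Fin.lt_def] using hi, rfl⟩
  · intros
    rfl

theorem prod_range_prod_Icc_comm (m : ℕ) (f : ℕ → ℕ → M) :
    ∏ i ∈ Finset.range (m + 1), ∏ j ∈ Finset.Icc (i + 1) m, f i j =
      ∏ j ∈ Finset.range (m + 1), ∏ i ∈ Finset.range j, f i j := by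
  refine Finset.prod_comm' ?_
  intro i j
  simp only [Finset.mem_range, Finset.mem_Icc]
  omega

theorem prod_fin_prod_Ioi (m : ℕ) (f : ℕ → ℕ → M) :
    ∏ i : Fin (m + 1), ∏ j ∈ Finset.Ioi i, f i j =
      ∏ j ∈ Finset.range (m + 1), ∏ i ∈ Finset.range j, f i j := by
  rw [← prod_range_prod_Icc_comm, ← Fin.prod_univ_eq_prod_range
    (fun i => ∏ j ∈ Finset.Icc (i + 1) m, f i j)]
  exact Finset.prod_congr rfl fun i _ => prod_Ioi_fin_eq_prod_Icc i (f i)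

theorem prod_range_shift_eq_prod_Icc (m : ℕ) (f : ℕ → M) :
    ∏ i ∈ Finset.range m, f (i + 1) = ∏ i ∈ Finset.Icc 1 m, f i := by
  induction m with
  | zero => simp
  | succ m ih => rw [Finset.prod_range_succ, ih, Finset.prod_Icc_succ_top (by omega)]

theorem prod_range_succ_eq_prod_Icc (m : ℕ) (f : ℕ → M) (h0 : f 0 = 1) :
    ∏ i ∈ Finset.range (m + 1), f i = ∏ i ∈ Finset.Icc 1 m, f i := by
  rw [Finset.prod_range_succ', h0, mul_one, prod_range_shift_eq_prod_Icc]

theorem prod_Icc_pow_succ (m : ℕ) (f : ℕ → M) :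
    ∏ l ∈ Finset.Icc 1 (m + 1), f l ^ (m + 1 + 1 - l) =
      (∏ l ∈ Finset.Icc 1 m, f l ^ (m + 1 - l)) * ∏ l ∈ Finset.Icc 1 (m + 1), f l := by
  rw [Finset.prod_Icc_succ_top (by omega), Finset.prod_Icc_succ_top (by omega), ← mul_assoc,
    ← Finset.prod_mul_distrib]
  congr 1
  · refine Finset.prod_congr rfl fun l hl => ?_
    rw [Finset.mem_Icc] at hl
    rw [← pow_succ]
    congr 1
    omega
  · simp

theorem prod_Icc_reflect (m : ℕ) (f : ℕ → M) :
    ∏ i ∈ Finset.Icc 1 m, f (m + 1 - i) = ∏ l ∈ Finset.Icc 1 m, f l := by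
  refine Finset.prod_nbij' (fun i => m + 1 - i) (fun i => m + 1 - i) ?_ ?_ ?_ ?_ ?_ <;>
    intro i hi <;> simp only [Finset.mem_Icc] at hi ⊢ <;> omega

theorem prod_Icc_prod_Icc_sub (m : ℕ) (f : ℕ → M) :
    ∏ j ∈ Finset.Icc 1 m, ∏ i ∈ Finset.Icc 1 j, f (j + 1 - i) =
      ∏ l ∈ Finset.Icc 1 m, f l ^ (m + 1 - l) := by
  induction m with
  | zero => simp
  | succ m ih =>
    rw [Finset.prod_Icc_succ_top (by omega), ih, prod_Icc_reflect, prod_Icc_pow_succ]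

/-- Among the pairs `i < j ≤ m`, the difference `l` occurs `m + 1 - l` times. -/
theorem prod_range_prod_range_sub (m : ℕ) (f : ℕ → M) :
    ∏ j ∈ Finset.range (m + 1), ∏ i ∈ Finset.range j, f (j - i) =
      ∏ l ∈ Finset.Icc 1 m, f l ^ (m + 1 - l) := by
  rw [prod_range_succ_eq_prod_Icc m (fun j => ∏ i ∈ Finset.range j, f (j - i)) (by simp),
    ← prod_Icc_prod_Icc_sub]
  refine Finset.prod_congr rfl fun j _ => ?_
  rw [← prod_range_shift_eq_prod_Icc]
  exact Finset.prod_congr rfl fun i _ => by rw [Nat.add_sub_add_right]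

theorem prod_range_prod_range_const (m : ℕ) (x : M) :
    ∏ j ∈ Finset.range (m + 1), ∏ _i ∈ Finset.range j, x = x ^ Nat.choose (m + 1) 2 := by
  simp only [Finset.prod_const, Finset.card_range]
  rw [Finset.prod_pow_eq_pow_sum, Finset.sum_range_id, Nat.choose_two_right]

end Products

/-! ### Determinants of products of binary linear forms -/

section LinearForms

variable {R : Type*} [CommRing R]

theorem exists_coeff_prod_linear {ι : Type*} (s : Finset ι) (a b : ι → R) :
    ∃ c : ℕ → R, ∀ p q : R, ∏ f ∈ s, (p * a f + q * b f) =
      ∑ l ∈ Finset.range (s.card + 1), q ^ l * p ^ (s.card - l) * c l := by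
  classical
  induction s using Finset.induction_on with
  | empty => exact ⟨fun _ => 1, fun p q => by simp⟩
  | insert x s hx ih =>
    obtain ⟨c, hc⟩ := ih
    -- A Pascal-type recursion. The guards matter: `c` is unconstrained above `s.card`, and `l - 1`
    -- truncates at `l = 0`.
    refine ⟨fun l => (if l ≤ s.card then a x * c l else 0) +
      (if 1 ≤ l then b x * c (l - 1) else 0), fun p q => ?_⟩
    rw [Finset.prod_insert hx, hc, Finset.card_insert_of_notMem hx, add_mul]
    simp only [mul_add, Finset.sum_add_distrib]
    congr 1
    · rw [Finset.sum_range_succ _ (s.card + 1), Finset.mul_sum, if_neg (by omega), mul_zero,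
        add_zero]
      refine Finset.sum_congr rfl fun l hl => ?_
      rw [Finset.mem_range] at hl
      rw [if_pos (by omega), show s.card + 1 - l = s.card - l + 1 by omega, pow_succ]
      ring
    · rw [Finset.sum_range_succ' _ (s.card + 1), Finset.mul_sum]
      simp only [Nat.le_zero, one_ne_zero, if_false, mul_zero, add_zero]
      refine Finset.sum_congr rfl fun l hl => ?_
      rw [if_pos (by omega), Nat.add_sub_add_right, Nat.add_sub_cancel, pow_succ]
      ring

theorem prod_linear_split (m j : ℕ) (hj : j ≤ m) (a b c d : ℕ → R) (p q : R) :
    (∏ f ∈ Finset.Icc (j + 1) m, (p * a f + q * b f)) *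
        ∏ g ∈ Finset.Icc 1 j, (p * c g + q * d g) =
      ∏ f ∈ Finset.Icc 1 m,
        (p * (if f ≤ j then c f else a f) + q * (if f ≤ j then d f else b f)) := by
  have h : Finset.Icc 1 m = Finset.Icc (j + 1) m ∪ Finset.Icc 1 j := by
    ext x
    simp only [Finset.mem_Icc, Finset.mem_union]
    omega
  have hd : Disjoint (Finset.Icc (j + 1) m) (Finset.Icc 1 j) := by
    rw [Finset.disjoint_left]
    intro x
    simp only [Finset.mem_Icc]
    omega
  rw [h, Finset.prod_union hd]
  congr 1
  · refine Finset.prod_congr rfl fun f hf => ?_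
    rw [Finset.mem_Icc] at hf
    rw [if_neg (by omega), if_neg (by omega)]
  · refine Finset.prod_congr rfl fun f hf => ?_
    rw [Finset.mem_Icc] at hf
    rw [if_pos (by omega), if_pos (by omega)]

/-- The matrix of values at `(p_i, q_i)` of the products of linear forms
`∏_{f > j} (a_f, b_f) · ∏_{1 ≤ g ≤ j} (c_g, d_g)`. -/
def linearProductMatrix (m : ℕ) (a b c d p q : ℕ → R) : Matrix (Fin (m + 1)) (Fin (m + 1)) R :=
  Matrix.of fun i j =>
    (∏ f ∈ Finset.Icc ((j : ℕ) + 1) m, (p i * a f + q i * b f)) *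
      ∏ g ∈ Finset.Icc 1 (j : ℕ), (p i * c g + q i * d g)

/-- The point is the order of quantifiers: one `C` serves all `p, q`, so `det C` can be computed at
a convenient choice of points. -/
theorem exists_linearProductMatrix_eq_mul (m : ℕ) (a b c d : ℕ → R) :
    ∃ C : Matrix (Fin (m + 1)) (Fin (m + 1)) R, ∀ p q : ℕ → R,
      linearProductMatrix m a b c d p q =
        Matrix.projVandermonde (fun i => q (i : ℕ)) (fun i => p (i : ℕ)) * C := by
  choose C hC using fun j : ℕ => exists_coeff_prod_linear (Finset.Icc 1 m)
    (fun f => if f ≤ j then c f else a f) (fun f => if f ≤ j then d f else b f)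
  refine ⟨Matrix.of fun l j => C j l, fun p q => ?_⟩
  ext i j
  rw [linearProductMatrix, Matrix.of_apply, prod_linear_split _ _ (by omega), hC, Matrix.mul_apply,
    Nat.card_Icc, Nat.add_sub_cancel, ← Fin.sum_univ_eq_sum_range
      (fun l => q i ^ l * p i ^ (m - l) * C j l)]
  refine Finset.sum_congr rfl fun l _ => ?_
  rw [Matrix.projVandermonde_apply, Matrix.of_apply, Fin.val_rev, Nat.add_sub_add_right]

theorem det_projVandermonde_nat (m : ℕ) (p q : ℕ → R) :
    (Matrix.projVandermonde (fun i : Fin (m + 1) => q (i : ℕ)) (fun i => p (i : ℕ))).det =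
      ∏ j ∈ Finset.range (m + 1), ∏ i ∈ Finset.range j, (p i * q j - q i * p j) := by
  rw [Matrix.det_projVandermonde, ← prod_fin_prod_Ioi m fun i j => p i * q j - q i * p j]
  exact Finset.prod_congr rfl fun i _ => Finset.prod_congr rfl fun j _ => by ring

/-- Row `i` is evaluated at the zero `(-b i, a i)` of the `i`-th form, which is a factor of every
entry with `j < i`; only the diagonal product remains. -/
theorem det_linearProductMatrix_at_roots (m : ℕ) (a b c d : ℕ → R) :
    (linearProductMatrix m a b c d (fun i => -b i) a).det =
      (∏ j ∈ Finset.range (m + 1), ∏ i ∈ Finset.range j, (-b i * a j - a i * -b j)) *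
        ∏ j ∈ Finset.Icc 1 m, ∏ i ∈ Finset.Icc 1 j, (a j * d i - b j * c i) := by
  rw [Matrix.det_of_isUpperTriangular]
  · simp only [linearProductMatrix, Matrix.of_apply]
    rw [Fin.prod_univ_eq_prod_range (fun i => (∏ f ∈ Finset.Icc (i + 1) m,
      (-b i * a f + a i * b f)) * ∏ g ∈ Finset.Icc 1 i, (-b i * c g + a i * d g)),
      Finset.prod_mul_distrib, prod_range_prod_Icc_comm, prod_range_succ_eq_prod_Icc m
        (fun i => ∏ g ∈ Finset.Icc 1 i, (-b i * c g + a i * d g)) (by simp)]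
    congr 1 <;> refine Finset.prod_congr rfl fun i _ => Finset.prod_congr rfl fun j _ => by ring
  · intro i j hij
    have hij' : (j : ℕ) < i := hij
    have hi := i.isLt
    rw [linearProductMatrix, Matrix.of_apply, Finset.prod_eq_zero (i := (i : ℕ)), zero_mul]
    · rw [Finset.mem_Icc]
      omega
    · ring

theorem det_linearProductMatrix_of_ne [IsDomain R] (m : ℕ) (a b c d p q : ℕ → R)
    (h : ∀ i j, i ≠ j → -b i * a j - a i * -b j ≠ 0) :
    (linearProductMatrix m a b c d p q).det =
      (∏ j ∈ Finset.range (m + 1), ∏ i ∈ Finset.range j, (p i * q j - q i * p j)) *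
        ∏ j ∈ Finset.Icc 1 m, ∏ i ∈ Finset.Icc 1 j, (a j * d i - b j * c i) := by
  obtain ⟨C, hC⟩ := exists_linearProductMatrix_eq_mul m a b c d
  have h1 := det_linearProductMatrix_at_roots m a b c d
  rw [hC, Matrix.det_mul, det_projVandermonde_nat m (fun i => -b i) a] at h1
  rw [hC, Matrix.det_mul, det_projVandermonde_nat, mul_left_cancel₀ ?_ h1]
  refine Finset.prod_ne_zero_iff.2 fun j _ => Finset.prod_ne_zero_iff.2 fun i hi => h _ _ ?_
  rw [Finset.mem_range] at hi
  omega

theorem linearProductMatrix_map {S : Type*} [CommRing S] (φ : R →+* S) (m : ℕ)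
    (a b c d p q : ℕ → R) :
    φ.mapMatrix (linearProductMatrix m a b c d p q) =
      linearProductMatrix m (φ ∘ a) (φ ∘ b) (φ ∘ c) (φ ∘ d) (φ ∘ p) (φ ∘ q) := by
  ext i j
  simp [linearProductMatrix]

/-- The nondegeneracy condition is removed by proving the identity for indeterminate `a, b` and then
specialising. -/
theorem det_linearProductMatrix [IsDomain R] [CharZero R] (m : ℕ) (a b c d p q : ℕ → R) :
    (linearProductMatrix m a b c d p q).det =
      (∏ j ∈ Finset.range (m + 1), ∏ i ∈ Finset.range j, (p i * q j - q i * p j)) *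
        ∏ j ∈ Finset.Icc 1 m, ∏ i ∈ Finset.Icc 1 j, (a j * d i - b j * c i) := by
  let A : ℕ → MvPolynomial (ℕ ⊕ ℕ) R := fun n => MvPolynomial.X (Sum.inl n)
  let B : ℕ → MvPolynomial (ℕ ⊕ ℕ) R := fun n => MvPolynomial.X (Sum.inr n)
  let φ : MvPolynomial (ℕ ⊕ ℕ) R →+* R := MvPolynomial.eval (Sum.elim a b)
  let K : R →+* MvPolynomial (ℕ ⊕ ℕ) R := MvPolynomial.C
  have hne : ∀ i j, i ≠ j → -B i * A j - A i * -B j ≠ 0 := by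
    intro i j hij h0
    -- At `a = 1`, `b n = n` the minor becomes `j - i`, nonzero in characteristic zero.
    let e : ℕ ⊕ ℕ → R := Sum.elim (fun _ => 1) fun n => (n : R)
    have h1 := congrArg (MvPolynomial.eval e) h0
    simp only [A, B, e, map_sub, map_mul, map_neg, MvPolynomial.eval_X, Sum.elim_inl, Sum.elim_inr,
      map_zero, mul_one, one_mul, sub_neg_eq_add] at h1
    exact hij (Nat.cast_injective (R := R) (by linear_combination -h1))
  have h := congrArg φ (det_linearProductMatrix_of_ne m A B (K ∘ c) (K ∘ d) (K ∘ p) (K ∘ q) hne)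
  have hA : φ ∘ A = a := by ext n; simp [φ, A]
  have hB : φ ∘ B = b := by ext n; simp [φ, B]
  have hA' : ∀ n, φ (A n) = a n := congrFun hA
  have hB' : ∀ n, φ (B n) = b n := congrFun hB
  have hK : ∀ f : ℕ → R, φ ∘ (K ∘ f) = f := fun f => by ext n; simp [φ, K]
  have hK' : ∀ r : R, φ (K r) = r := fun r => by simp [φ, K]
  rw [RingHom.map_det, linearProductMatrix_map, hA, hB, hK, hK, hK, hK] at h
  simpa only [map_mul, map_prod, map_sub, Function.comp_apply, hA', hB', hK'] using h

/-- A matrix of values of products of `m` linear forms is singular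
as soon as its size exceeds `m + 1`. -/
theorem det_prod_linear_eq_zero {ι : Type*} (s : Finset ι) (n : ℕ) (hn : s.card + 1 < n)
    (a b : Fin n → ι → R) (p q : Fin n → R) :
    (Matrix.of fun i j : Fin n => ∏ f ∈ s, (p i * a j f + q i * b j f)).det = 0 := by
  choose C hC using fun j : Fin n => exists_coeff_prod_linear s (a j) (b j)
  have h : (Matrix.of fun i j : Fin n => ∏ f ∈ s, (p i * a j f + q i * b j f)) =
      (Matrix.of fun i l : Fin n =>
        if (l : ℕ) ≤ s.card then q i ^ (l : ℕ) * p i ^ (s.card - l) else 0) *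
        Matrix.of fun l j : Fin n => C j l := by
    ext i j
    simp only [Matrix.mul_apply, Matrix.of_apply]
    rw [hC, Fin.sum_univ_eq_sum_range
      (fun l => (if l ≤ s.card then q i ^ l * p i ^ (s.card - l) else 0) * C j l),
      ← Finset.sum_subset (Finset.range_subset_range.2 hn.le)]
    · refine Finset.sum_congr rfl fun l hl => ?_
      rw [Finset.mem_range] at hl
      rw [if_pos (by omega)]
    · intro l _ hl
      rw [Finset.mem_range] at hl
      rw [if_neg (by omega), zero_mul]
  -- The left factor was padded with zero columns to make it square.
  rw [h, Matrix.det_mul, Matrix.det_eq_zero_of_column_eq_zero ⟨s.card + 1, hn⟩, zero_mul]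
  intro i
  simp

theorem det_pow_linear (m : ℕ) (p q u w : ℕ → R) :
    (Matrix.of fun i j : Fin (m + 1) => (p i * u j + q i * w j) ^ m).det =
      (∏ i ∈ Finset.range (m + 1), (m.choose i : R)) *
        (∏ j ∈ Finset.range (m + 1), ∏ i ∈ Finset.range j, (p i * q j - q i * p j)) *
        ∏ j ∈ Finset.range (m + 1), ∏ i ∈ Finset.range j, (u i * w j - w i * u j) := by
  have h : (Matrix.of fun i j : Fin (m + 1) => (p i * u j + q i * w j) ^ m) =
      Matrix.projVandermonde (fun i : Fin (m + 1) => q (i : ℕ)) (fun i => p (i : ℕ)) *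
        Matrix.diagonal (fun i : Fin (m + 1) => (m.choose i : R)) *
        (Matrix.projVandermonde (fun i : Fin (m + 1) => w (i : ℕ))
          (fun i => u (i : ℕ))).transpose := by
    ext i j
    rw [Matrix.mul_apply, Matrix.of_apply, add_comm, add_pow, ← Fin.sum_univ_eq_sum_range
      (fun l => (q i * w j) ^ l * (p i * u j) ^ (m - l) * (m.choose l : R))]
    refine Finset.sum_congr rfl fun l _ => ?_
    rw [Matrix.mul_diagonal, Matrix.transpose_apply, Matrix.projVandermonde_apply,
      Matrix.projVandermonde_apply, Fin.val_rev, Nat.add_sub_add_right, mul_pow, mul_pow]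
    ring
  rw [h, Matrix.det_mul, Matrix.det_mul, Matrix.det_transpose, det_projVandermonde_nat,
    det_projVandermonde_nat, Matrix.det_diagonal,
    Fin.prod_univ_eq_prod_range (fun l => (m.choose l : R))]
  ring

end LinearForms

/-! ### Chebyshev identities and the determinants -/

section Chebyshev

theorem eq_of_chebyshev_recurrence {F G : ℤ → ℝ[X]}
    (hF : ∀ n, F (n + 2) = 2 * X * F (n + 1) - F n)
    (hG : ∀ n, G (n + 2) = 2 * X * G (n + 1) - G n) (h0 : F 0 = G 0) (h1 : F 1 = G 1) (n : ℤ) :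
    F n = G n := by
  induction n using Polynomial.Chebyshev.induct with
  | zero => exact h0
  | one => exact h1
  | add_two n ih1 ih0 => rw [hF, hG, ih0, ih1]
  | neg_add_one n ih0 ih1 =>
    have hf := hF (-(n : ℤ) - 1)
    have hg := hG (-(n : ℤ) - 1)
    rw [show -(n : ℤ) - 1 + 2 = -n + 1 by ring, show -(n : ℤ) - 1 + 1 = -n by ring] at hf hg
    rw [ih0, ih1] at hf
    linear_combination hf - hg

/-- With `x = cos θ` this is the cosine addition formula, since `chebS (a - 1)` is `sin (aθ) / sin
θ`. -/
theorem chebT_add (a b : ℤ) :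
    chebT (a + b) = chebT a * chebT b + (X ^ 2 - 1) * chebS (a - 1) * chebS (b - 1) := by
  refine eq_of_chebyshev_recurrence (F := fun b => chebT (a + b))
    (G := fun b => chebT a * chebT b + (X ^ 2 - 1) * chebS (a - 1) * chebS (b - 1)) ?_ ?_ ?_ ?_ b
  · intro n
    simp only [← add_assoc]
    exact Chebyshev.T_add_two ℝ (a + n)
  · intro n
    have h1 := Chebyshev.T_add_two ℝ n
    have h2 := Chebyshev.U_add_two ℝ (n - 1)
    rw [show n - 1 + 2 = n + 2 - 1 by ring, show n - 1 + 1 = n + 1 - 1 by ring] at h2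
    simp only [h1, h2]
    ring
  · simp
  · have h := Chebyshev.T_eq_X_mul_T_sub_pol_U ℝ (a - 1)
    rw [show a - 1 + 2 = a + 1 by ring, show a - 1 + 1 = a by ring] at h
    simp only [h, Chebyshev.T_one, sub_self, Chebyshev.U_zero]
    ring

/-- The sine subtraction formula divided by `sin θ`. -/
theorem chebT_mul_chebS_sub (a b : ℤ) :
    chebT a * chebS (b - 1) - chebS (a - 1) * chebT b = chebS (b - a - 1) := by
  refine eq_of_chebyshev_recurrence
    (F := fun b => chebT a * chebS (b - 1) - chebS (a - 1) * chebT b)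
    (G := fun b => chebS (b - a - 1)) ?_ ?_ ?_ ?_ b
  · intro n
    have h1 := Chebyshev.T_add_two ℝ n
    have h2 := Chebyshev.U_add_two ℝ (n - 1)
    rw [show n - 1 + 2 = n + 2 - 1 by ring, show n - 1 + 1 = n + 1 - 1 by ring] at h2
    simp only [h1, h2]
    ring
  · intro n
    have h := Chebyshev.U_add_two ℝ (n - a - 1)
    rwa [show n - a - 1 + 2 = n + 2 - a - 1 by ring,
      show n - a - 1 + 1 = n + 1 - a - 1 by ring] at h
  · simp only [zero_sub, Chebyshev.U_neg_one, mul_zero, Chebyshev.T_zero, mul_one]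
    exact (Chebyshev.U_neg_sub_one ℝ a).symm
  · have h := Chebyshev.T_eq_X_mul_U_sub_U ℝ (a - 2)
    have h' := Chebyshev.U_neg_sub_one ℝ (a - 1)
    rw [show a - 2 + 2 = a by ring, show a - 2 + 1 = a - 1 by ring] at h
    rw [show -(a - 1) - 1 = 1 - a - 1 by ring, show a - 1 - 1 = a - 2 by ring] at h'
    simp only [h, h', Chebyshev.T_one, sub_self, Chebyshev.U_zero]
    ring

theorem chebT_arith (s k n i t : ℤ) :
    chebT (s + k * (n + i + t)) =
      chebT (k * i) * chebT (s + k * (n + t)) +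
        (X ^ 2 - 1) * chebS (k * i - 1) * chebS (s + k * (n + t) - 1) := by
  rw [← chebT_add]
  congr 1
  ring

theorem prod_chebyshev_pairs (m : ℕ) (k : ℤ) :
    ∏ j ∈ Finset.range (m + 1), ∏ i ∈ Finset.range j,
        (chebT (k * (i : ℤ)) * ((X ^ 2 - 1) * chebS (k * (j : ℤ) - 1)) -
          (X ^ 2 - 1) * chebS (k * (i : ℤ) - 1) * chebT (k * (j : ℤ))) =
      (X ^ 2 - 1) ^ Nat.choose (m + 1) 2 *
        ∏ l ∈ Finset.Icc 1 m, chebS (k * (l : ℤ) - 1) ^ (m + 1 - l) := by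
  rw [← prod_range_prod_range_sub m fun l : ℕ => chebS (k * (l : ℤ) - 1),
    ← prod_range_prod_range_const]
  simp only [← Finset.prod_mul_distrib]
  refine Finset.prod_congr rfl fun j _ => Finset.prod_congr rfl fun i hi => ?_
  rw [Finset.mem_range] at hi
  have h := chebT_mul_chebS_sub (k * (i : ℤ)) (k * (j : ℤ))
  rw [Nat.cast_sub hi.le, mul_sub, ← h]
  ring

theorem prod_chebyshev_shift_pairs (m : ℕ) (s k n : ℤ) :
    ∏ j ∈ Finset.range (m + 1), ∏ i ∈ Finset.range j,
        (chebT (s + k * (n + (i : ℤ))) * chebS (s + k * (n + (j : ℤ)) - 1) -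
          chebS (s + k * (n + (i : ℤ)) - 1) * chebT (s + k * (n + (j : ℤ)))) =
      ∏ l ∈ Finset.Icc 1 m, chebS (k * (l : ℤ) - 1) ^ (m + 1 - l) := by
  rw [← prod_range_prod_range_sub m fun l : ℕ => chebS (k * (l : ℤ) - 1)]
  refine Finset.prod_congr rfl fun j _ => Finset.prod_congr rfl fun i hi => ?_
  rw [Finset.mem_range] at hi
  rw [chebT_mul_chebS_sub, Nat.cast_sub hi.le]
  congr 1
  ring

theorem prod_range_pow_two_mul_sub {M : Type*} [CommMonoid M] (m : ℕ) (f : ℕ → M) :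
    ∏ i ∈ Finset.range (m + 1), f (i + 1) ^ (2 * (m - i)) =
      (∏ l ∈ Finset.Icc 1 m, f l ^ (m + 1 - l)) * ∏ l ∈ Finset.Icc 1 m, f l ^ (m + 1 - l) := by
  rw [Finset.prod_range_succ, Nat.sub_self, mul_zero, pow_zero, mul_one,
    ← Finset.prod_mul_distrib, ← prod_range_shift_eq_prod_Icc]
  refine Finset.prod_congr rfl fun i _ => ?_
  rw [← pow_add, Nat.add_sub_add_right, two_mul]

theorem det_chebT_pow (m : ℕ) (s k n : ℤ) :
    Matrix.det (Matrix.of fun i j : Fin (m + 1) =>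
        chebT (s + k * (n + (i : ℤ) + (j : ℤ))) ^ m)
      = (X ^ 2 - 1) ^ Nat.choose (m + 1) 2 *
        ∏ i ∈ Finset.range (m + 1),
          ((Nat.choose m i : ℝ[X]) * chebS (((i : ℤ) + 1) * k - 1) ^ (2 * (m - i))) := by
  have h := det_pow_linear m (fun i => chebT (k * (i : ℤ)))
    (fun i => (X ^ 2 - 1) * chebS (k * (i : ℤ) - 1))
    (fun j => chebT (s + k * (n + (j : ℤ)))) (fun j => chebS (s + k * (n + (j : ℤ)) - 1))
  rw [prod_chebyshev_pairs, prod_chebyshev_shift_pairs] at h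
  simp only [← chebT_arith] at h
  have h2 := prod_range_pow_two_mul_sub m fun l : ℕ => chebS (k * (l : ℤ) - 1)
  simp only [Nat.cast_add, Nat.cast_one] at h2
  rw [Finset.prod_mul_distrib]
  simp only [mul_comm _ k]
  rw [h2, h]
  ring

theorem det_prod_chebT (m : ℕ) (s k n : ℤ) (δ ε : ℕ → ℤ) :
    Matrix.det (Matrix.of fun i j : Fin (m + 1) =>
        (∏ f ∈ Finset.Icc ((j : ℕ) + 1) m, chebT (s + k * (n + (i : ℤ) + δ f))) *
          ∏ g ∈ Finset.Icc 1 (j : ℕ), chebT (s + k * (n + (i : ℤ) + ε g)))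
      = (X ^ 2 - 1) ^ Nat.choose (m + 1) 2 *
        (∏ l ∈ Finset.Icc 1 m, chebS (k * (l : ℤ) - 1) ^ (m + 1 - l)) *
        ∏ j ∈ Finset.Icc 1 m, ∏ i ∈ Finset.Icc 1 j, chebS (k * (ε i - δ j) - 1) := by
  have h := det_linearProductMatrix m
    (fun f => chebT (s + k * (n + δ f))) (fun f => chebS (s + k * (n + δ f) - 1))
    (fun g => chebT (s + k * (n + ε g))) (fun g => chebS (s + k * (n + ε g) - 1))
    (fun i => chebT (k * (i : ℤ))) (fun i => (X ^ 2 - 1) * chebS (k * (i : ℤ) - 1))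
  rw [prod_chebyshev_pairs] at h
  simp only [linearProductMatrix, ← chebT_arith, chebT_mul_chebS_sub] at h
  rw [h]
  congr 1
  refine Finset.prod_congr rfl fun j _ => Finset.prod_congr rfl fun i _ => ?_
  congr 1
  ring

theorem prod_Icc_prod_Icc_const {M : Type*} [CommMonoid M] (m : ℕ) (x : M) :
    ∏ j ∈ Finset.Icc 1 m, ∏ _i ∈ Finset.Icc 1 j, x = x ^ Nat.choose (m + 1) 2 := by
  rw [← prod_range_prod_range_const, prod_range_succ_eq_prod_Icc m _ (by simp)]
  simp

theorem det_prod_chebT_omit (m : ℕ) (s k n : ℤ) :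
    Matrix.det (Matrix.of fun i j : Fin (m + 1) =>
        ∏ t ∈ Finset.univ.erase j, chebT (s + k * (n + (i : ℤ) + ((t : Fin (m + 1)) : ℤ))))
      = (-X ^ 2 + 1) ^ Nat.choose (m + 1) 2 *
          ∏ i ∈ Finset.range (m + 1), chebS (k * ((i : ℤ) + 1) - 1) ^ (2 * (m - i)) := by
  -- In column `j` the shifts are `j + 1, …, m` and `0, …, j - 1`: everything but `j`.
  have h := det_prod_chebT m s k n (fun f => (f : ℤ)) (fun g => (g : ℤ) - 1)
  -- The reflection `S_{-a-1} = -S_{a-1}` costs one sign per pair, which turns `X ^ 2 - 1` into `-X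
  -- ^ 2 + 1`.
  have hS : ∀ j ∈ Finset.Icc 1 m, ∀ i ∈ Finset.Icc 1 j,
      chebS (k * ((i : ℤ) - 1 - (j : ℤ)) - 1) = -1 * chebS (k * ((j + 1 - i : ℕ) : ℤ) - 1) := by
    intro j _ i hi
    rw [Finset.mem_Icc] at hi
    rw [Nat.cast_sub (by omega), neg_one_mul, ← Chebyshev.U_neg_sub_one]
    congr 1
    push_cast
    ring
  rw [Finset.prod_congr rfl fun j hj => Finset.prod_congr rfl (hS j hj)] at h
  simp only [Finset.prod_mul_distrib] at h
  rw [prod_Icc_prod_Icc_const, prod_Icc_prod_Icc_sub m fun l : ℕ => chebS (k * (l : ℤ) - 1)] at h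
  have h2 := prod_range_pow_two_mul_sub m fun l : ℕ => chebS (k * (l : ℤ) - 1)
  simp only [Nat.cast_add, Nat.cast_one] at h2
  rw [h2, show (-X ^ 2 + 1 : ℝ[X]) = (X ^ 2 - 1) * -1 by ring, mul_pow]
  refine Eq.trans (congrArg Matrix.det ?_) (h.trans (by ring))
  ext1 i j
  simp only [Matrix.of_apply]
  have hU : (Finset.univ.erase j : Finset (Fin (m + 1))) = Finset.Ioi j ∪ Finset.Iio j := by
    ext t
    simp only [Finset.mem_erase, Finset.mem_univ, Finset.mem_union, Finset.mem_Ioi,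
      Finset.mem_Iio, and_true, ne_iff_lt_or_gt, or_comm]
  have hd : Disjoint (Finset.Ioi j) (Finset.Iio j) := by
    rw [Finset.disjoint_left]
    intro t h1 h2
    exact lt_asymm (Finset.mem_Ioi.1 h1) (Finset.mem_Iio.1 h2)
  rw [hU, Finset.prod_union hd,
    prod_Ioi_fin_eq_prod_Icc j fun t => chebT (s + k * (n + (i : ℤ) + (t : ℤ))),
    ← prod_range_shift_eq_prod_Icc j]
  congr 1
  simp only [Nat.cast_add, Nat.cast_one, add_sub_cancel_right]
  exact prod_Iio_fin_eq_prod_range j fun t => chebT (s + k * (n + (i : ℤ) + (t : ℤ)))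

/-- The determinant of the reciprocals of Chebyshev polynomials under a ring homomorphism
to a field at which no denominator vanishes. -/
theorem det_one_div_chebT {K : Type*} [Field K] (φ : ℝ[X] →+* K) (m : ℕ) (s k n : ℤ)
    (hφ : ∀ i j : Fin (m + 1), φ (chebT (s + k * (n + (i : ℤ) + (j : ℤ)))) ≠ 0) :
    Matrix.det (Matrix.of fun i j : Fin (m + 1) =>
        1 / φ (chebT (s + k * (n + (i : ℤ) + (j : ℤ)))))
      = φ ((-X ^ 2 + 1) ^ Nat.choose (m + 1) 2 *
            ∏ i ∈ Finset.range (m + 1), chebS (k * ((i : ℤ) + 1) - 1) ^ (2 * (m - i))) /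
        φ (∏ i ∈ Finset.range (m + 1), ∏ j ∈ Finset.range (m + 1),
              chebT (s + k * (n + (i : ℤ) + (j : ℤ)))) := by
  -- Row `i` is put over the common denominator of its entries.
  have hM : (Matrix.of fun i j : Fin (m + 1) =>
      1 / φ (chebT (s + k * (n + (i : ℤ) + (j : ℤ))))) =
      Matrix.of fun i j : Fin (m + 1) =>
        (∏ t : Fin (m + 1), φ (chebT (s + k * (n + (i : ℤ) + (t : ℤ)))))⁻¹ *
        φ.mapMatrix (Matrix.of fun i j : Fin (m + 1) => ∏ t ∈ Finset.univ.erase j,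
          chebT (s + k * (n + (i : ℤ) + ((t : Fin (m + 1)) : ℤ)))) i j := by
    ext i j
    simp only [Matrix.of_apply, RingHom.mapMatrix_apply, Matrix.map_apply, map_prod]
    rw [← Finset.mul_prod_erase Finset.univ _ (Finset.mem_univ j), mul_inv, mul_assoc,
      inv_mul_cancel₀ (Finset.prod_ne_zero_iff.2 fun t _ => hφ i t), mul_one, one_div]
  rw [hM, Matrix.det_mul_column, ← RingHom.map_det, det_prod_chebT_omit, Finset.prod_inv_distrib,
    mul_comm, ← div_eq_mul_inv]
  congr 1
  simp only [map_prod]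
  rw [← Fin.prod_univ_eq_prod_range (fun i => ∏ j ∈ Finset.range (m + 1),
    φ (chebT (s + k * (n + (i : ℤ) + (j : ℤ)))))]
  exact Finset.prod_congr rfl fun i _ => Fin.prod_univ_eq_prod_range
    (fun j => φ (chebT (s + k * (n + (i : ℤ) + (j : ℤ))))) (m + 1)

/-- The window `[j, m + j)` splits into `[j, D)`, `[D, m)` and `[m, m + j)`. The middle piece does
not depend on `j`, so it leaves the determinant as a row factor. -/
theorem risingPower_factor (P : ℤ → ℝ[X]) (n : ℤ) {m D j : ℕ} (hD : D ≤ m) (hj : j ≤ D) :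
    risingPower P (n + (j : ℤ)) m = risingPower P (n + (D : ℤ)) (m - D) *
      ((∏ f ∈ Finset.Icc (j + 1) D, P (n + ((f : ℤ) - 1))) *
        ∏ g ∈ Finset.Icc 1 j, P (n + ((m : ℤ) + (g : ℤ) - 1))) := by
  have h1 : risingPower P (n + (j : ℤ)) m = ∏ t ∈ Finset.Ico j (m + j), P (n + (t : ℤ)) := by
    rw [Finset.prod_Ico_eq_prod_range, Nat.add_sub_cancel, risingPower]
    simp only [Nat.cast_add, add_assoc]
  have h2 : risingPower P (n + (D : ℤ)) (m - D) = ∏ t ∈ Finset.Ico D m, P (n + (t : ℤ)) := by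
    rw [Finset.prod_Ico_eq_prod_range, risingPower]
    simp only [Nat.cast_add, add_assoc]
  have h3 : ∏ f ∈ Finset.Icc (j + 1) D, P (n + ((f : ℤ) - 1)) =
      ∏ t ∈ Finset.Ico j D, P (n + (t : ℤ)) := by
    rw [← Finset.Ico_add_one_right_eq_Icc,
      ← Finset.prod_Ico_add' (fun f : ℕ => P (n + ((f : ℤ) - 1))) j D 1]
    simp
  have h4 : ∏ g ∈ Finset.Icc 1 j, P (n + ((m : ℤ) + (g : ℤ) - 1)) =
      ∏ t ∈ Finset.Ico m (m + j), P (n + (t : ℤ)) := by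
    rw [Finset.prod_Ico_eq_prod_range, Nat.add_sub_cancel_left, ← prod_range_shift_eq_prod_Icc]
    refine Finset.prod_congr rfl fun t _ => ?_
    congr 1
    push_cast
    ring
  rw [h1, h2, h3, h4, ← Finset.prod_Ico_consecutive _ hj (by omega : D ≤ m + j),
    ← Finset.prod_Ico_consecutive _ hD (by omega : m ≤ m + j)]
  ring

theorem even_choose_sign (d : ℕ) :
    Even (d * Nat.choose d 2 + Nat.choose (d + 1) 3 + Nat.choose d 2) := by
  have h := Nat.add_one_mul_choose_eq d 2
  -- `(d + 1) * choose d 2 = 3 * choose (d + 1) 3`, so the whole sum is `4 * choose (d + 1) 3`.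
  exact ⟨2 * Nat.choose (d + 1) 3, by linarith⟩

theorem neg_one_pow_mul_choose (d : ℕ) :
    (-1) ^ (d * Nat.choose d 2 + Nat.choose (d + 1) 3) * (-X ^ 2 + 1) ^ Nat.choose d 2 =
      ((X ^ 2 - 1) ^ Nat.choose d 2 : ℝ[X]) := by
  rw [show (-X ^ 2 + 1 : ℝ[X]) = -1 * (X ^ 2 - 1) by ring, mul_pow, ← mul_assoc, ← pow_add,
    (even_choose_sign d).neg_one_pow, one_mul]

theorem det_risingPower_chebT (m D : ℕ) (hD : D ≤ m) (n : ℤ) :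
    Matrix.det (Matrix.of fun i j : Fin (D + 1) =>
        risingPower chebT (n + (i : ℤ) + (j : ℤ)) m)
      = (X ^ 2 - 1) ^ Nat.choose (D + 1) 2 *
        (∏ i ∈ Finset.Icc 1 D,
          (chebS ((i : ℤ) - 1) * chebS ((m : ℤ) - (i : ℤ))) ^ (D + 1 - i)) *
        ∏ i ∈ Finset.Icc D (2 * D), risingPower chebT (n + (i : ℤ)) (m - D) := by
  have h := det_prod_chebT D 0 1 n (fun f => (f : ℤ) - 1) (fun g => (m : ℤ) + (g : ℤ) - 1)
  simp only [zero_add, one_mul] at h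
  have hM : (Matrix.of fun i j : Fin (D + 1) =>
      risingPower chebT (n + (i : ℤ) + (j : ℤ)) m) =
      Matrix.of fun i j : Fin (D + 1) =>
        risingPower chebT (n + (i : ℤ) + (D : ℤ)) (m - D) *
        (Matrix.of fun i j : Fin (D + 1) =>
          (∏ f ∈ Finset.Icc ((j : ℕ) + 1) D, chebT (n + (i : ℤ) + ((f : ℤ) - 1))) *
            ∏ g ∈ Finset.Icc 1 (j : ℕ), chebT (n + (i : ℤ) + ((m : ℤ) + (g : ℤ) - 1))) i j := by
    ext1 i j
    exact risingPower_factor chebT (n + (i : ℤ)) hD (by omega)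
  have hS : ∀ j ∈ Finset.Icc 1 D, ∀ i ∈ Finset.Icc 1 j,
      chebS ((m : ℤ) + (i : ℤ) - 1 - ((j : ℤ) - 1) - 1) =
        chebS ((m : ℤ) - ((j + 1 - i : ℕ) : ℤ)) := by
    intro j _ i hi
    rw [Finset.mem_Icc] at hi
    rw [Nat.cast_sub (by omega)]
    congr 1
    push_cast
    ring
  have hR : ∏ i : Fin (D + 1), risingPower chebT (n + (i : ℤ) + (D : ℤ)) (m - D) =
      ∏ i ∈ Finset.Icc D (2 * D), risingPower chebT (n + (i : ℤ)) (m - D) := by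
    rw [← Finset.Ico_add_one_right_eq_Icc, Finset.prod_Ico_eq_prod_range,
      show 2 * D + 1 - D = D + 1 by omega, ← Fin.prod_univ_eq_prod_range
        (fun i => risingPower chebT (n + ((D + i : ℕ) : ℤ)) (m - D))]
    refine Finset.prod_congr rfl fun i _ => ?_
    congr 1
    push_cast
    ring
  rw [hM, Matrix.det_mul_column, h, hR,
    Finset.prod_congr rfl fun j hj => Finset.prod_congr rfl (hS j hj),
    prod_Icc_prod_Icc_sub D fun l : ℕ => chebS ((m : ℤ) - (l : ℤ))]
  simp only [mul_pow, Finset.prod_mul_distrib]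
  ring

theorem det_risingPower_chebT_eq_zero (m d : ℕ) (hd : m + 1 < d) (n : ℤ) :
    Matrix.det (Matrix.of fun i j : Fin d =>
      risingPower chebT (n + (i : ℤ) + (j : ℤ)) m) = 0 := by
  have h := det_prod_linear_eq_zero (Finset.range m) d (by simpa using hd)
    (fun (j : Fin d) t => chebT (n + (j : ℤ) + (t : ℤ)))
    (fun (j : Fin d) t => chebS (n + (j : ℤ) + (t : ℤ) - 1))
    (fun i : Fin d => chebT (i : ℤ)) (fun i : Fin d => (X ^ 2 - 1) * chebS ((i : ℤ) - 1))
  simp only [← chebT_add] at h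
  rw [← h]
  congr 1
  ext1 i j
  simp only [Matrix.of_apply, risingPower]
  refine Finset.prod_congr rfl fun t _ => ?_
  congr 1
  ring

end Chebyshev

/-! ### Assembly of the identities -/

theorem corollary4 (m d : ℕ) (hm : 1 ≤ m) (hd : 1 ≤ d) (s k n : ℤ) (δ ε : ℕ → ℤ) :
    -- powers of Chebyshev polynomials
    (Matrix.det (Matrix.of fun i j : Fin (m + 1) =>
        chebT (s + k * (n + (i : ℤ) + (j : ℤ))) ^ m)
      = (X ^ 2 - 1) ^ Nat.choose (m + 1) 2 *
        ∏ i ∈ Finset.range (m + 1),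
          ((Nat.choose m i : ℝ[X]) * chebS (((i : ℤ) + 1) * k - 1) ^ (2 * (m - i)))) ∧
    -- products of Chebyshev polynomials with shifts `δ_1, …, δ_m` and `ε_1, …, ε_m`
    (Matrix.det (Matrix.of fun i j : Fin (m + 1) =>
        (∏ f ∈ Finset.Icc ((j : ℕ) + 1) m, chebT (s + k * (n + (i : ℤ) + δ f))) *
          ∏ g ∈ Finset.Icc 1 (j : ℕ), chebT (s + k * (n + (i : ℤ) + ε g)))
      = (X ^ 2 - 1) ^ Nat.choose (m + 1) 2 *
        (∏ l ∈ Finset.Icc 1 m, chebS (k * (l : ℤ) - 1) ^ (m + 1 - l)) *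
        ∏ j ∈ Finset.Icc 1 m, ∏ i ∈ Finset.Icc 1 j, chebS (k * (ε i - δ j) - 1)) ∧
    -- reciprocals of Chebyshev polynomials, as rational functions
    (Matrix.det (Matrix.of fun i j : Fin (m + 1) =>
        1 / algebraMap ℝ[X] (RatFunc ℝ) (chebT (s + k * (n + (i : ℤ) + (j : ℤ)))))
      = algebraMap ℝ[X] (RatFunc ℝ)
            ((-X ^ 2 + 1) ^ Nat.choose (m + 1) 2 *
              ∏ i ∈ Finset.range (m + 1), chebS (k * ((i : ℤ) + 1) - 1) ^ (2 * (m - i))) /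
          algebraMap ℝ[X] (RatFunc ℝ)
            (∏ i ∈ Finset.range (m + 1), ∏ j ∈ Finset.range (m + 1),
              chebT (s + k * (n + (i : ℤ) + (j : ℤ))))) ∧
    -- reciprocals, at every real point where no denominator vanishes
    (∀ x : ℝ, (∀ i j : Fin (m + 1), (chebT (s + k * (n + (i : ℤ) + (j : ℤ)))).eval x ≠ 0) →
      Matrix.det (Matrix.of fun i j : Fin (m + 1) =>
          1 / (chebT (s + k * (n + (i : ℤ) + (j : ℤ)))).eval x)
        = ((-x ^ 2 + 1) ^ Nat.choose (m + 1) 2 *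
            ∏ i ∈ Finset.range (m + 1),
              (chebS (k * ((i : ℤ) + 1) - 1)).eval x ^ (2 * (m - i))) /
          ∏ i ∈ Finset.range (m + 1), ∏ j ∈ Finset.range (m + 1),
            (chebT (s + k * (n + (i : ℤ) + (j : ℤ)))).eval x) ∧
    -- rising powers of Chebyshev polynomials
    (d ≤ m + 1 →
      Matrix.det (Matrix.of fun i j : Fin d =>
          risingPower chebT (n + (i : ℤ) + (j : ℤ)) m)
        = (-1) ^ (d * Nat.choose d 2 + Nat.choose (d + 1) 3) *
          (-X ^ 2 + 1) ^ Nat.choose d 2 *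
          (∏ i ∈ Finset.Icc 1 (d - 1),
            (chebS ((i : ℤ) - 1) * chebS ((m : ℤ) - (i : ℤ))) ^ (d - i)) *
          ∏ i ∈ Finset.Icc (d - 1) (2 * (d - 1)),
            risingPower chebT (n + (i : ℤ)) (m + 1 - d)) ∧
    -- rising powers for `d > m + 1`: the product on the right contains `S_{-1} = 0`
    (m + 1 < d →
      Matrix.det (Matrix.of fun i j : Fin d =>
          risingPower chebT (n + (i : ℤ) + (j : ℤ)) m) = 0) := by
  refine ⟨det_chebT_pow m s k n, det_prod_chebT m s k n δ ε, ?_, ?_, ?_,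
    fun h => det_risingPower_chebT_eq_zero m d h n⟩
  · refine det_one_div_chebT _ m s k n fun i j => ?_
    rw [Ne, FaithfulSMul.algebraMap_eq_zero_iff]
    exact Chebyshev.T_ne_zero ℝ _
  · intro x hx
    -- The pointwise identity uses evaluation at `x` in place of the embedding into rational
    -- functions.
    have h := det_one_div_chebT (evalRingHom x) m s k n hx
    simpa [eval_prod] using h
  · intro h
    obtain ⟨D, rfl⟩ : ∃ D, d = D + 1 := ⟨d - 1, by omega⟩
    rw [neg_one_pow_mul_choose, Nat.add_sub_cancel, Nat.add_sub_add_right]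
    exact det_risingPower_chebT m D (by omega) n
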